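/- Let $\rho$ be a measure on $\mathbb{R}$, $h\ge 0$ measurable, and consider the natural exponential family of distributions $P_\theta$ with $\rho$-densities $p(x,\theta)=h(x)\exp(x\theta-A(\theta))$, $\theta\in\Theta=\{\theta\in\mathbb{R}:\int h(x)e^{x\theta}\rho(dx)<\infty\}$, $A(\theta)=\log\int h(x)e^{x\theta}\rho(dx)$, whose members are assumed non-degenerate (not concentrated on a single point). Write $D(\theta,\theta')$ for the Kullback–Leibler divergence of $P_\theta$ from $P_{\theta'}$, i.e. $D(\theta,\theta')=\mathbb{E}_\theta[\log(p(X,\theta)/p(X,\theta'))]$. An algorithm $\pi$ (non-anticipating, possibly randomized) for the two-armed bandit chooses in each period one of two arms on the basis of the past plays and rewards; in the environment $\nu=(\theta_1,\theta_2)\in\Theta^2$ each play of arm $k$ yields an independent reward with law $P_{\theta_k}$. Let $\mathbb{P}_{\nu\pi}$, $\mathbb{E}_{\nu\pi}$ denote the resulting law and expectation, and $N_k(T)$ the number of plays of arm $k$ in the first $T$ periods. Assume: (A1) $\pi$ is optimized: for every environment $\nu=(\theta_1,\theta_2)$ and every arm $k$ that is sub-optimal in $\nu$ (i.e. $\theta_k<\theta_j$,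 where $j$ is the other arm), $\lim_{T\to\infty}\mathbb{E}_{\nu\pi}[N_k(T)]/\log T=1/D(\theta_k,\theta_j)$. (A2) $\inf\Theta=-\infty$ and $\lim_{\theta\to-\infty}\big(\theta A'(\theta)-A(\theta)\big)=\infty$. Then for every environment $\nu=(\theta_1,\theta_2)$ in which arm $2$ is sub-optimal ($\theta_1>\theta_2$) and all $0<\delta'<\delta$, $$\liminf_{T\to\infty}\frac{\mathbb{E}_{\nu\pi}\big[N_2(T)^{1+\delta}\big]}{T^{\delta'}}\ \ge\ 1 .$$ -/

import Mathlib

open MeasureTheory ProbabilityTheory Filter Topology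

/-- A natural one-parameter exponential family on `ℝ`, with densities
`p(x, θ) = h(x) exp(x θ - A(θ))` with respect to a dominating measure `ρ`. -/
structure ExpFamily where
  /-- the dominating measure -/
  ρ : Measure ℝ
  /-- the carrier function -/
  h : ℝ → ℝ
  measurable_h : Measurable h
  h_nonneg : ∀ x, 0 ≤ h x
  /-- the distributions are non-degenerate: `h` times `ρ` is not concentrated on a single point
  (in particular it is not the zero measure) -/
  nondegenerate : ∀ c : ℝ, ¬ ∀ᵐ x ∂ρ, x ≠ c → h x = 0

namespace ExpFamily

/-- The natural parameter space: all `θ` with `∫ h(x) exp(x θ) ρ(dx) < ∞`. -/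
def Θ (M : ExpFamily) : Set ℝ :=
  {θ | Integrable (fun x => M.h x * Real.exp (x * θ)) M.ρ}

/-- The log-partition function `A`. -/
noncomputable def A (M : ExpFamily) (θ : ℝ) : ℝ :=
  Real.log (∫ x, M.h x * Real.exp (x * θ) ∂M.ρ)

/-- The density `p(x, θ)`. -/
noncomputable def p (M : ExpFamily) (x θ : ℝ) : ℝ :=
  M.h x * Real.exp (x * θ - M.A θ)

/-- The reward distribution with parameter `θ`. -/
noncomputable def P (M : ExpFamily) (θ : ℝ) : Measure ℝ :=
  M.ρ.withDensity (fun x => ENNReal.ofReal (M.p x θ))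

/-- The Kullback-Leibler divergence `D(θ₁, θ₂)` between the members with parameters
`θ₁` and `θ₂`. -/
noncomputable def D (M : ExpFamily) (θ₁ θ₂ : ℝ) : ℝ :=
  (InformationTheory.klDiv (M.P θ₁) (M.P θ₂)).toReal

lemma partition_pos (M : ExpFamily) {θ : ℝ} (hθ : θ ∈ M.Θ) :
    0 < ∫ x, M.h x * Real.exp (x * θ) ∂M.ρ := by
  have hnn : ∀ x, 0 ≤ M.h x * Real.exp (x * θ) := fun x =>
    mul_nonneg (M.h_nonneg x) (Real.exp_pos _).le
  refine lt_of_le_of_ne (integral_nonneg hnn) fun h0 => M.nondegenerate 0 ?_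
  have := (integral_eq_zero_iff_of_nonneg hnn hθ).1 h0.symm
  filter_upwards [this] with x hx _
  simpa using hx

instance isProbabilityMeasure_P (M : ExpFamily) (θ : M.Θ) : IsProbabilityMeasure (M.P θ) := by
  have hpos := M.partition_pos θ.2
  have hp : ∀ x, M.p x θ
      = M.h x * Real.exp (x * θ) * (∫ x, M.h x * Real.exp (x * θ) ∂M.ρ)⁻¹ := by
    intro x
    rw [p, A, Real.exp_sub, Real.exp_log hpos]
    ring
  constructor
  rw [P, withDensity_apply _ MeasurableSet.univ, Measure.restrict_univ,
    ← ofReal_integral_eq_lintegral_ofReal]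
  · simp_rw [hp]
    rw [integral_mul_const, mul_inv_cancel₀ hpos.ne', ENNReal.ofReal_one]
  · simp_rw [hp]
    exact Integrable.mul_const θ.2 _
  · exact Filter.Eventually.of_forall fun x => mul_nonneg (M.h_nonneg x) (Real.exp_pos _).le

/-- The condition on the left tail of the family:
`inf Θ = -∞` and `θ A'(θ) - A(θ) → ∞` as `θ → -∞`. -/
def LeftTailCondition (M : ExpFamily) : Prop :=
  ¬ BddBelow M.Θ ∧ Tendsto (fun θ => θ * deriv M.A θ - M.A θ) atBot atTop

end ExpFamily

/-- A (possibly randomized, non-anticipating) algorithm for the two-armed bandit: a distribution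
for the first arm, and for every later period a Markov kernel from the past (arms played and
rewards received, periods `0, …, n`) to the arm of the next period. Arm `1` of the mathematical
text is `0 : Fin 2` and arm `2` is `1 : Fin 2`. -/
structure BanditAlgorithm where
  first : Measure (Fin 2)
  next : ∀ n : ℕ, Kernel (Finset.Iic n → Fin 2 × ℝ) (Fin 2)
  [isProbabilityMeasure_first : IsProbabilityMeasure first]
  [isMarkovKernel_next : ∀ n, IsMarkovKernel (next n)]

namespace BanditAlgorithm

attribute [instance] isProbabilityMeasure_first isMarkovKernel_next

/-- The reward kernel: playing arm `k` produces a reward with law `ν k`. -/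
noncomputable def rewardKernel (ν : Fin 2 → Measure ℝ) : Kernel (Fin 2) ℝ :=
  Kernel.ofFunOfCountable ν

instance (ν : Fin 2 → Measure ℝ) [∀ k, IsProbabilityMeasure (ν k)] :
    IsMarkovKernel (rewardKernel ν) :=
  ⟨fun k => inferInstanceAs (IsProbabilityMeasure (ν k))⟩

/-- The law of the infinite sequence of (arm, reward) pairs when the algorithm `π` operates in the
environment with reward distributions `ν`. In each period the arm is drawn by `π` given the past,
and then the reward is drawn from the distribution of that arm, independently of the past. -/
noncomputable def law (π : BanditAlgorithm) (ν : Fin 2 → Measure ℝ)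
    [∀ k, IsProbabilityMeasure (ν k)] : Measure (ℕ → Fin 2 × ℝ) :=
  Kernel.trajMeasure (X := fun _ => Fin 2 × ℝ) (π.first ⊗ₘ rewardKernel ν)
    (fun n => π.next n ⊗ₖ Kernel.prodMkLeft _ (rewardKernel ν))

end BanditAlgorithm

/-- `N_k(T)`: the number of plays of arm `k` in the first `T` periods. -/
def numPlays (k : Fin 2) (T : ℕ) (ω : ℕ → Fin 2 × ℝ) : ℕ :=
  ((Finset.range T).filter fun t => (ω t).1 = k).card

namespace ExpFamily

/-- The law of the interaction of `π` with the environment `ν = (θ₁, θ₂)` of the family. -/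
noncomputable def banditLaw (M : ExpFamily) (π : BanditAlgorithm) (ν : Fin 2 → M.Θ) :
    Measure (ℕ → Fin 2 × ℝ) :=
  π.law (fun k => M.P (ν k))

/-- The algorithm is optimized over the family: in every environment, for a sub-optimal arm `k`
(the other arm being `j`), `E[N_k(T)] / log T → 1 / D(θ_k, θ_j)`. Both labellings of the arms are
covered; for an algorithm that is invariant under swapping the labels, one of them suffices. -/
def IsOptimized (M : ExpFamily) (π : BanditAlgorithm) : Prop :=
  ∀ (ν : Fin 2 → M.Θ) (j k : Fin 2), ν k < ν j →
    Tendsto (fun T : ℕ => (∫ ω, (numPlays k T ω : ℝ) ∂(M.banditLaw π ν)) / Real.log T) atTop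
      (𝓝 (1 / M.D (ν k) (ν j)))

end ExpFamily

/-!
The proof is a change of measure. Let `θ` be a parameter below `θ₂`, and consider the environment
`(θ, θ₂)`, which differs from `(θ₁, θ₂)` only in the rewards of the first arm. There the first arm is
sub-optimal, so that an optimized algorithm plays it about `log T / D(θ, θ₂)` times in expectation;
by Markov's inequality the second arm receives at least half of the plays with probability tending
to one (`BanditAlgorithm.one_sub_le_law_real_half`). The histories of the first `T` rounds in the two
environments have a likelihood ratio that involves only the rewards of the first arm
(`BanditAlgorithm.lintegral_law_eq`), and its expected logarithm is `E[N₁(T)] D(θ, θ₁)`, which is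
about `(D(θ, θ₁) / D(θ, θ₂)) log T`. By the inequality behind data processing for the
Kullback-Leibler divergence (`exp_neg_mul_le_measureReal`), the event that the second arm receives
half of the plays has in the original environment a probability of at least `T ^ (-r)` for large `T`,
for every `r > D(θ, θ₁) / D(θ, θ₂)`.

The left-tail condition makes this ratio of divergences as close to one as desired: the divergence is
the Bregman divergence of `A` (`ExpFamily.D_eq`), and
`D(θ, θ₁) - D(θ, θ₂) = A(θ₁) - A(θ₂) - (θ₁ - θ₂) A'(θ)` is of smaller order than `D(θ, θ₂)` as
`θ → -∞` (`ExpFamily.exists_D_lt_mul_D`). Hence every `r > 1` is admissible, and the event contributes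
at least `(T / 2) ^ (1 + δ) * T ^ (-r)` to the moment of order `1 + δ`. This exceeds `T ^ δ'` as soon as
`r < 1 + δ - δ'` and `T` is large.
-/

/-! ### Exponential families as tilted measures -/

namespace ExpFamily

/-- The measure `h(x) ρ(dx)`, of which every member of the family is an exponential tilt. -/
noncomputable def base (M : ExpFamily) : Measure ℝ :=
  M.ρ.withDensity fun x => ENNReal.ofReal (M.h x)

variable (M : ExpFamily)

lemma integral_base (f : ℝ → ℝ) : ∫ x, f x ∂M.base = ∫ x, M.h x * f x ∂M.ρ := by
  rw [base]
  rw [integral_withDensity_eq_integral_toReal_smul (by have := M.measurable_h; fun_prop)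
    (ae_of_all _ fun x => ENNReal.ofReal_lt_top)]
  simp [ENNReal.toReal_ofReal (M.h_nonneg _)]

lemma integrable_base_iff (f : ℝ → ℝ) :
    Integrable f M.base ↔ Integrable (fun x => M.h x * f x) M.ρ := by
  rw [base, integrable_withDensity_iff_integrable_smul' (by have := M.measurable_h; fun_prop)
    (ae_of_all _ fun x => ENNReal.ofReal_lt_top)]
  simp [ENNReal.toReal_ofReal (M.h_nonneg _)]

lemma Θ_eq_integrableExpSet : M.Θ = integrableExpSet id M.base := by
  ext θ
  simp only [Θ, integrableExpSet, Set.mem_ofPred_eq, integrable_base_iff, id, mul_comm θ]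

lemma A_eq_cgf : M.A = cgf id M.base := by
  ext θ
  simp only [A, cgf, mgf, integral_base, id, mul_comm θ]

variable {M}

lemma integrable_exp_base {θ : ℝ} (hθ : θ ∈ M.Θ) :
    Integrable (fun x => Real.exp (θ * id x)) M.base := by
  rwa [Θ_eq_integrableExpSet] at hθ

lemma P_eq_tilted {θ : ℝ} (hθ : θ ∈ M.Θ) : M.P θ = M.base.tilted (θ * id ·) := by
  have hh := M.measurable_h
  rw [P, Measure.tilted, base, ← withDensity_mul _ (by fun_prop) (by fun_prop)]
  congr 1
  ext x
  rw [Pi.mul_apply, ← ENNReal.ofReal_mul (M.h_nonneg x), p, Real.exp_sub, A,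
    Real.exp_log (M.partition_pos hθ)]
  have := M.integral_base fun x => Real.exp (x * θ)
  rw [base] at this
  simp only [id, mul_comm θ, this]

lemma P_eq_tilted_P {θ θ' : ℝ} (hθ : θ ∈ M.Θ) (hθ' : θ' ∈ M.Θ) :
    M.P θ' = (M.P θ).tilted fun x => (θ' - θ) * x := by
  rw [P_eq_tilted hθ, P_eq_tilted hθ', tilted_tilted (integrable_exp_base hθ)]
  congr 1
  ext x
  simp only [Pi.add_apply, id]
  ring

lemma integral_exp_mul_P {θ θ' : ℝ} (hθ : θ ∈ M.Θ) (hθ' : θ' ∈ M.Θ) :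
    ∫ x, Real.exp ((θ' - θ) * x) ∂M.P θ = Real.exp (M.A θ' - M.A θ) := by
  rw [P_eq_tilted hθ, integral_exp_tilted, Real.exp_sub, A, A, Real.exp_log (M.partition_pos hθ),
    Real.exp_log (M.partition_pos hθ'), ← integral_base, ← integral_base]
  congr 2
  · ext x
    simp only [Pi.add_apply, id]
    ring_nf
  · ext x
    simp only [id]
    ring_nf

lemma P_eq_withDensity_P {θ θ' : ℝ} (hθ : θ ∈ M.Θ) (hθ' : θ' ∈ M.Θ) :
    M.P θ' = (M.P θ).withDensity fun x =>
      ENNReal.ofReal (Real.exp (-(M.A θ' - M.A θ - (θ' - θ) * x))) := by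
  rw [P_eq_tilted_P hθ hθ', Measure.tilted, integral_exp_mul_P hθ hθ']
  congr 1
  ext x
  rw [← Real.exp_sub]
  ring_nf

lemma integrable_id_P {θ : ℝ} (hθ : θ ∈ interior M.Θ) : Integrable (fun x => x) (M.P θ) := by
  rw [P_eq_tilted (interior_subset hθ)]
  rw [Θ_eq_integrableExpSet] at hθ
  exact memLp_one_iff_integrable.1 (by exact_mod_cast memLp_tilted_mul hθ 1)

lemma integral_id_P {θ : ℝ} (hθ : θ ∈ interior M.Θ) : ∫ x, x ∂M.P θ = deriv M.A θ := by
  rw [P_eq_tilted (interior_subset hθ), A_eq_cgf]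
  rw [Θ_eq_integrableExpSet] at hθ
  exact integral_tilted_mul_self hθ

lemma integral_logRatio_P {θ : ℝ} (hθ : θ ∈ interior M.Θ) (θ' : ℝ) :
    ∫ x, (M.A θ' - M.A θ - (θ' - θ) * x) ∂M.P θ
      = M.A θ' - M.A θ - (θ' - θ) * deriv M.A θ := by
  have : IsProbabilityMeasure (M.P θ) := M.isProbabilityMeasure_P ⟨θ, interior_subset hθ⟩
  rw [integral_sub (integrable_const _) ((integrable_id_P hθ).const_mul _), integral_const_mul,
    integral_id_P hθ]
  simp

/-- The divergence as the Bregman divergence of the log-partition function. -/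
lemma D_eq {θ θ' : ℝ} (hθ : θ ∈ interior M.Θ) (hθ' : θ' ∈ M.Θ) :
    M.D θ θ' = M.A θ' - M.A θ - (θ' - θ) * deriv M.A θ := by
  have hθm := interior_subset hθ
  have h1 : IsProbabilityMeasure (M.P θ) := M.isProbabilityMeasure_P ⟨θ, hθm⟩
  have h2 : IsProbabilityMeasure (M.P θ') := M.isProbabilityMeasure_P ⟨θ', hθ'⟩
  have hint : Integrable (fun x => Real.exp ((θ' - θ) * x)) (M.P θ) := by
    refine Integrable.of_integral_ne_zero ?_
    rw [integral_exp_mul_P hθm hθ']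
    positivity
  have hP := P_eq_tilted_P hθm hθ'
  have hac : M.P θ ≪ M.P θ' := by
    rw [hP]
    exact absolutelyContinuous_tilted hint
  rw [D, InformationTheory.toReal_klDiv_of_measure_eq hac (by simp), hP,
    integral_llr_tilted_right Measure.AbsolutelyContinuous.rfl
      ((integrable_id_P hθ).const_mul _) hint ?_,
    integral_exp_mul_P hθm hθ', Real.log_exp, integral_const_mul, integral_id_P hθ,
    integral_congr_ae (llr_self (M.P θ))]
  · simp
    ring
  · exact (integrable_congr (llr_self (M.P θ))).2 (integrable_zero _ _ _)

lemma Iio_subset_Θ (hM : ¬ BddBelow M.Θ) {θ : ℝ} (hθ : θ ∈ M.Θ) : Set.Iio θ ⊆ M.Θ := by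
  intro t ht
  obtain ⟨s, hs, hst⟩ := not_bddBelow_iff.1 hM t
  have hc : M.Θ.OrdConnected := by
    rw [Θ_eq_integrableExpSet]
    exact convex_integrableExpSet.ordConnected
  exact hc.out hs hθ ⟨hst.le, (Set.mem_Iio.1 ht).le⟩

/-- Under the left-tail condition, moving the reward parameter far to the left makes the
divergences from two fixed members asymptotically equal. With `x = A'(θ)`,
`D(θ, θ') = (θ x - A(θ)) - θ' x + A(θ')`, so that `D(θ, θ₁) - D(θ, θ₂)` is `-(θ₁ - θ₂) x` up to a
constant. Nonnegativity of `D(θ, θ₂ - d)` bounds `-x` by `D(θ, θ₂) / d` up to a constant, and `d` may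
be taken large because `Θ` is unbounded below. Together with nonnegativity of `D(θ, θ₁)`, this also
bounds `|x|` in terms of `D(θ, θ₂)`, which therefore cannot stay bounded. -/
lemma exists_D_lt_mul_D (hM : M.LeftTailCondition) {θ₁ θ₂ r : ℝ} (h1 : θ₁ ∈ M.Θ) (h2 : θ₂ ∈ M.Θ)
    (h21 : θ₂ < θ₁) (hr : 1 < r) :
    ∃ θ ∈ interior M.Θ, θ < θ₂ ∧ 0 < M.D θ θ₂ ∧ M.D θ θ₁ < r * M.D θ θ₂ := by
  obtain ⟨hbdd, hg⟩ := hM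
  have hsub := Iio_subset_Θ hbdd h2
  set s := θ₁ - θ₂ with hs
  have hs0 : 0 < s := sub_pos.2 h21
  -- with this `d`, the multiple `s / d` of `D θ θ₂` lost below is `(r - 1) / 2`, half of the margin
  set d := 2 * s / (r - 1) with hd
  have hr0 : 0 < r - 1 := sub_pos.2 hr
  have hd0 : 0 < d := by positivity
  have h0 : θ₂ - d ∈ M.Θ := hsub (by simp [hd0])
  set C₁ := |M.A θ₁ - M.A θ₂|
  set C₀ := |M.A (θ₂ - d) - M.A θ₂|
  set K := C₀ + 2 * C₁ / (r - 1) with hK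
  have hK0 : 0 ≤ K := by positivity
  obtain ⟨θ, hθg, hθ2⟩ := ((hg.eventually_gt_atTop
    (K + |θ₂| * ((K + C₁) / s + (K + C₀) / d) + |M.A θ₂|)).and (eventually_lt_atBot θ₂)).exists
  have hθ : θ ∈ interior M.Θ := interior_mono hsub (by rwa [interior_Iio])
  have e0 := D_eq hθ h0
  have e1 := D_eq hθ h1
  have e2 := D_eq hθ h2
  have p0 : 0 ≤ M.D θ (θ₂ - d) := ENNReal.toReal_nonneg
  have p1 : 0 ≤ M.D θ θ₁ := ENNReal.toReal_nonneg
  set x := deriv M.A θ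
  have c0 : M.A (θ₂ - d) - M.A θ₂ ≤ C₀ := le_abs_self _
  have c1 : M.A θ₁ - M.A θ₂ ≤ C₁ := le_abs_self _
  have C₁0 : 0 ≤ C₁ := abs_nonneg _
  have C₀0 : 0 ≤ C₀ := abs_nonneg _
  have hx1 : d * (-x) ≤ M.D θ θ₂ + C₀ := by nlinarith
  have hx2 : s * x ≤ M.D θ θ₂ + C₁ := by rw [hs]; nlinarith
  have hD2 : K < M.D θ θ₂ := by
    by_contra! hle
    have hx1' : -x ≤ (K + C₀) / d := by rw [le_div_iff₀ hd0]; linarith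
    have hx2' : x ≤ (K + C₁) / s := by rw [le_div_iff₀ hs0]; linarith
    have q1 : 0 ≤ (K + C₀) / d := by positivity
    have q2 : 0 ≤ (K + C₁) / s := by positivity
    have hx : |x| ≤ (K + C₁) / s + (K + C₀) / d := abs_le.2 ⟨by linarith, by linarith⟩
    have hθx : θ₂ * x ≤ |θ₂| * ((K + C₁) / s + (K + C₀) / d) :=
      (le_abs_self _).trans (by rw [abs_mul]; gcongr)
    have := neg_abs_le (M.A θ₂)
    linarith
  refine ⟨θ, hθ, hθ2, hK0.trans_lt hD2, ?_⟩
  have hsd : s = (r - 1) / 2 * d := by rw [hd]; field_simp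
  have h3 : s * (-x) ≤ (r - 1) / 2 * (M.D θ θ₂ + C₀) := by
    rw [hsd, mul_assoc]; gcongr
  have h4 : (r - 1) / 2 * K < (r - 1) / 2 * M.D θ θ₂ := by gcongr
  have h5 : (r - 1) / 2 * K = (r - 1) / 2 * C₀ + C₁ := by rw [hK]; field_simp
  have h6 : M.D θ θ₁ ≤ M.D θ θ₂ + s * (-x) + C₁ := by rw [e1, e2, hs]; linarith
  linarith

end ExpFamily

/-! ### The law of the interaction and change of environment -/

namespace BanditAlgorithm

open Preorder
open scoped ENNReal

variable (π : BanditAlgorithm) (ν ν' : Fin 2 → Measure ℝ)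
  [∀ k, IsProbabilityMeasure (ν k)] [∀ k, IsProbabilityMeasure (ν' k)]

instance : IsProbabilityMeasure (π.law ν) := by
  unfold law
  infer_instance

lemma map_eval_zero_law : (π.law ν).map (fun ω => ω 0) = π.first ⊗ₘ rewardKernel ν := by
  have h0 : (π.law ν).map (frestrictLe (π := fun _ => Fin 2 × ℝ) 0) =
      (π.first ⊗ₘ rewardKernel ν).map
        (MeasurableEquiv.piUnique fun _ : Finset.Iic 0 => Fin 2 × ℝ).symm := by
    rw [law, Kernel.trajMeasure, Measure.map_comp _ _ (by fun_prop), Kernel.traj_map_frestrictLe,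
      Kernel.partialTraj_self, Measure.id_comp]
  have h1 : (fun ω : ℕ → Fin 2 × ℝ => ω 0) =
      (MeasurableEquiv.piUnique fun _ : Finset.Iic 0 => Fin 2 × ℝ) ∘
        frestrictLe (π := fun _ => Fin 2 × ℝ) 0 := rfl
  rw [h1, ← Measure.map_map (by fun_prop) (by fun_prop), h0, Measure.map_map (by fun_prop)
    (by fun_prop)]
  exact Measure.map_id

/-- One round of interaction: the past is kept, an arm is drawn given the past, and then a reward
is drawn given the arm. -/
lemma lintegral_law_succ (n : ℕ) {f : (Finset.Iic n → Fin 2 × ℝ) × (Fin 2 × ℝ) → ℝ≥0∞}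
    (hf : Measurable f) :
    ∫⁻ ω, f (frestrictLe n ω, ω (n + 1)) ∂π.law ν =
      ∫⁻ ω, ∫⁻ a, ∫⁻ x, f (frestrictLe n ω, (a, x)) ∂ν a ∂π.next n (frestrictLe n ω) ∂π.law ν := by
  have h := Kernel.map_frestrictLe_trajMeasure_compProd_eq_map_trajMeasure
    (X := fun _ => Fin 2 × ℝ) (μ₀ := π.first ⊗ₘ rewardKernel ν)
    (κ := fun n => π.next n ⊗ₖ Kernel.prodMkLeft _ (rewardKernel ν)) (a := n)
  have e1 : ∫⁻ ω, f (frestrictLe n ω, ω (n + 1)) ∂π.law ν =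
      ∫⁻ y, f y ∂(π.law ν).map (fun ω => (frestrictLe n ω, ω (n + 1))) := by
    rw [lintegral_map hf (by fun_prop)]
  have e2 (u : Finset.Iic n → Fin 2 × ℝ) :
      ∫⁻ b, f (u, b) ∂(π.next n ⊗ₖ Kernel.prodMkLeft _ (rewardKernel ν)) u =
        ∫⁻ a, ∫⁻ x, f (u, (a, x)) ∂ν a ∂π.next n u := by
    rw [Kernel.lintegral_compProd _ _ _ (by fun_prop)]
    rfl
  rw [e1, law, ← h, Measure.lintegral_compProd hf]
  simp_rw [e2]
  rw [lintegral_map _ (by fun_prop)]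
  simp_rw [← e2]
  exact Measurable.lintegral_kernel_prod_right' hf

/-- In every round the reward has, given the arm, the law prescribed by the environment. -/
lemma map_eval_law (n : ℕ) :
    (π.law ν).map (fun ω => ω n) =
      ((π.law ν).map fun ω => (ω n).1) ⊗ₘ rewardKernel ν := by
  suffices h : ∃ m : Measure (Fin 2), IsProbabilityMeasure m ∧
      (π.law ν).map (fun ω => ω n) = m ⊗ₘ rewardKernel ν by
    obtain ⟨m, hm, h⟩ := h
    have : (π.law ν).map (fun ω => (ω n).1) = m := by
      rw [← Measure.fst_compProd m (rewardKernel ν), ← h, Measure.fst,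
        Measure.map_map (by fun_prop) (by fun_prop)]
      rfl
    rw [this, h]
  cases n with
  | zero => exact ⟨π.first, inferInstance, map_eval_zero_law π ν⟩
  | succ n =>
    refine ⟨((π.law ν).map (frestrictLe n)).bind (π.next n), ?_, ?_⟩
    · have : IsProbabilityMeasure ((π.law ν).map (frestrictLe n)) :=
        Measure.isProbabilityMeasure_map (by fun_prop)
      infer_instance
    · refine Measure.ext_of_lintegral _ fun f hf => ?_
      rw [lintegral_map hf (by fun_prop), Measure.lintegral_compProd hf,
        Measure.lintegral_bind (by fun_prop) (measurable_of_countable _).aemeasurable,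
        lintegral_map _ (by fun_prop),
        π.lintegral_law_succ ν n (f := fun y => f y.2) (by fun_prop)]
      · rfl
      · exact Measurable.lintegral_kernel (measurable_of_countable _)

/-- Change of measure between two environments, for functions of the first `n + 1` rounds: the
likelihood ratio of the histories is the product of the likelihood ratios of the rewards, since
the probabilities with which the algorithm chooses the arms cancel. -/
lemma lintegral_law_eq_frestrictLe {z : Fin 2 × ℝ → ℝ≥0∞} (hz : Measurable z)
    (hν : ∀ a, ν' a = (ν a).withDensity fun x => z (a, x)) (n : ℕ)
    {f : (Finset.Iic n → Fin 2 × ℝ) → ℝ≥0∞} (hf : Measurable f) :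
    ∫⁻ ω, f (frestrictLe n ω) ∂π.law ν' =
      ∫⁻ ω, f (frestrictLe n ω) * ∏ i : Finset.Iic n, z (ω i) ∂π.law ν := by
  have hstep (g : Fin 2 × ℝ → ℝ≥0∞) (hg : Measurable g) (a : Fin 2) :
      ∫⁻ x, g (a, x) ∂ν' a = ∫⁻ x, g (a, x) * z (a, x) ∂ν a := by
    rw [hν, lintegral_withDensity_eq_lintegral_mul _ (by fun_prop) (by fun_prop)]
    simp [mul_comm]
  induction n with
  | zero =>
    have h0 (ρ : Fin 2 → Measure ℝ) [∀ k, IsProbabilityMeasure (ρ k)]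
        (g : Fin 2 × ℝ → ℝ≥0∞) (hg : Measurable g) :
        ∫⁻ ω, g (ω 0) ∂π.law ρ = ∫⁻ a, ∫⁻ x, g (a, x) ∂ρ a ∂π.first := by
      rw [← lintegral_map (f := g) (g := fun ω : ℕ → Fin 2 × ℝ => ω 0) hg (by fun_prop),
        map_eval_zero_law, Measure.lintegral_compProd hg]
      rfl
    have hr (ω : ℕ → Fin 2 × ℝ) :
        f (frestrictLe (π := fun _ => Fin 2 × ℝ) 0 ω) = f fun _ => ω 0 := by
      congr 1
      ext1 i
      have := Finset.mem_Iic.1 i.2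
      simp only [frestrictLe_apply]
      congr 1
      omega
    have hp (ω : ℕ → Fin 2 × ℝ) : ∏ i : Finset.Iic 0, z (ω i) = z (ω 0) := by
      rw [Finset.prod_coe_sort (Finset.Iic 0) (fun i => z (ω i)),
        ← Nat.range_succ_eq_Iic, Finset.prod_range_one]
    have hf0 : Measurable fun y : Fin 2 × ℝ => f fun _ => y := by fun_prop
    calc ∫⁻ ω, f (frestrictLe 0 ω) ∂π.law ν'
      _ = ∫⁻ a, ∫⁻ x, f (fun _ => (a, x)) ∂ν' a ∂π.first :=
        (lintegral_congr hr).trans (h0 ν' _ hf0)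
      _ = ∫⁻ a, ∫⁻ x, f (fun _ => (a, x)) * z (a, x) ∂ν a ∂π.first :=
        lintegral_congr fun a => hstep _ hf0 a
      _ = ∫⁻ ω, f (frestrictLe 0 ω) * ∏ i : Finset.Iic 0, z (ω i) ∂π.law ν :=
        (h0 ν (fun y => f (fun _ => y) * z y) (by fun_prop)).symm.trans
          (lintegral_congr fun ω => (congrArg₂ (· * ·) (hr ω) (hp ω)).symm)
  | succ n ih =>
    -- a history of `n + 2` rounds, glued from one of `n + 1` rounds and the last round
    let glue : (Finset.Iic n → Fin 2 × ℝ) × (Fin 2 × ℝ) → (Finset.Iic (n + 1) → Fin 2 × ℝ) :=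
      fun y i => if hi : i.1 ≤ n then y.1 ⟨i, Finset.mem_Iic.2 hi⟩ else y.2
    have hglue : Measurable glue := by
      refine measurable_pi_lambda _ fun i => ?_
      by_cases hi : i.1 ≤ n
      · simp only [glue, hi, dite_true]
        exact measurable_fst.eval
      · simp only [glue, hi, dite_false]
        exact measurable_snd
    have hr (ω : ℕ → Fin 2 × ℝ) : frestrictLe (π := fun _ => Fin 2 × ℝ) (n + 1) ω =
        glue (frestrictLe n ω, ω (n + 1)) := by
      ext1 i
      have := Finset.mem_Iic.1 i.2
      by_cases hi : i.1 ≤ n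
      · simp [glue, hi]
      · have : i.1 = n + 1 := by omega
        simp [glue, this]
    have hp (ω : ℕ → Fin 2 × ℝ) : ∏ i : Finset.Iic (n + 1), z (ω i) =
        z (ω (n + 1)) * ∏ i : Finset.Iic n, z (frestrictLe (π := fun _ => Fin 2 × ℝ) n ω i) := by
      simp only [frestrictLe_apply]
      rw [Finset.prod_coe_sort (Finset.Iic (n + 1)) (fun i => z (ω i)),
        Finset.prod_coe_sort (Finset.Iic n) (fun i => z (ω i)),
        ← Nat.range_succ_eq_Iic, ← Nat.range_succ_eq_Iic, Finset.prod_range_succ, mul_comm]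
    simp_rw [hr, hp]
    rw [π.lintegral_law_succ ν' n (f := fun y => f (glue y)) (by fun_prop),
      ih (f := fun u => ∫⁻ a, ∫⁻ x, f (glue (u, (a, x))) ∂ν' a ∂π.next n u) ?_,
      π.lintegral_law_succ ν n (f := fun y => f (glue y) * (z y.2 * ∏ i, z (y.1 i)))
        (by fun_prop)]
    · refine lintegral_congr fun ω => ?_
      have hm (a : Fin 2) : Measurable fun x =>
          f (glue (frestrictLe (π := fun _ => Fin 2 × ℝ) n ω, (a, x))) * z (a, x) := by fun_prop
      simp_rw [hstep (fun y => f (glue (frestrictLe n ω, y))) (by fun_prop), ← mul_assoc,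
        lintegral_mul_const _ (hm _)]
      rw [lintegral_mul_const _ (measurable_of_countable _)]
      simp
    · have := Measurable.lintegral_kernel_prod_right'
        (κ := π.next n ⊗ₖ Kernel.prodMkLeft _ (rewardKernel ν')) (f := fun y => f (glue y))
        (by fun_prop)
      convert this using 2 with u
      rw [Kernel.lintegral_compProd _ _ _ (by fun_prop)]
      rfl

/-- The change of measure in terms of functions of the whole trajectory that depend on the first `T`
rounds only. -/
lemma lintegral_law_eq {z : Fin 2 × ℝ → ℝ≥0∞} (hz : Measurable z)
    (hν : ∀ a, ν' a = (ν a).withDensity fun x => z (a, x)) (T : ℕ)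
    {f : (ℕ → Fin 2 × ℝ) → ℝ≥0∞} (hf : Measurable f) (hfT : DependsOn f (Set.Iio T)) :
    ∫⁻ ω, f ω ∂π.law ν' = ∫⁻ ω, f ω * ∏ i ∈ Finset.range T, z (ω i) ∂π.law ν := by
  cases T with
  | zero =>
    have hc (ω : ℕ → Fin 2 × ℝ) : f ω = f fun _ => 0 := hfT fun i hi => by simp at hi
    simp [hc]
  | succ n =>
    let ext : (Finset.Iic n → Fin 2 × ℝ) → ℕ → Fin 2 × ℝ :=
      fun u i => if hi : i ≤ n then u ⟨i, Finset.mem_Iic.2 hi⟩ else 0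
    have hext : Measurable ext := by
      refine measurable_pi_lambda _ fun i => ?_
      by_cases hi : i ≤ n
      · simp only [ext, hi, dite_true]
        fun_prop
      · simp only [ext, hi, dite_false]
        fun_prop
    have hfe (ω : ℕ → Fin 2 × ℝ) : f (ext (frestrictLe n ω)) = f ω :=
      hfT fun i hi => by simp [ext, Nat.lt_succ_iff.1 hi]
    have h := π.lintegral_law_eq_frestrictLe ν ν' hz hν n (f := fun u => f (ext u)) (by fun_prop)
    simp_rw [hfe] at h
    rw [h]
    refine lintegral_congr fun ω => ?_
    rw [Finset.prod_coe_sort (Finset.Iic n) (fun i => z (ω i)), ← Nat.range_succ_eq_Iic]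

end BanditAlgorithm

/-! ### Counting plays -/

lemma numPlays_eq_sum (k : Fin 2) (T : ℕ) (ω : ℕ → Fin 2 × ℝ) :
    (numPlays k T ω : ℝ) = ∑ t ∈ Finset.range T, if (ω t).1 = k then 1 else 0 := by
  simp [numPlays]

lemma numPlays_le (k : Fin 2) (T : ℕ) (ω : ℕ → Fin 2 × ℝ) : numPlays k T ω ≤ T :=
  (Finset.card_filter_le _ _).trans (Finset.card_range T).le

lemma numPlays_zero_add_one (T : ℕ) (ω : ℕ → Fin 2 × ℝ) :
    numPlays 0 T ω + numPlays 1 T ω = T := by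
  have h (t : ℕ) : ((ω t).1 = 1) = ¬ (ω t).1 = 0 := by
    generalize (ω t).1 = a
    fin_cases a <;> simp
  simp_rw [numPlays, h]
  rw [Finset.card_filter_add_card_filter_not, Finset.card_range]

lemma dependsOn_numPlays (k : Fin 2) (T : ℕ) : DependsOn (numPlays k T) (Set.Iio T) := by
  intro ω ω' h
  simp only [numPlays]
  congr 1
  exact Finset.filter_congr fun t ht => by rw [h t (Finset.mem_range.1 ht)]

@[fun_prop]
lemma measurable_numPlays (k : Fin 2) (T : ℕ) : Measurable (numPlays k T) := by
  have h : numPlays k T = fun ω => ∑ t ∈ Finset.range T, if (ω t).1 = k then 1 else 0 := by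
    ext1 ω
    rw [numPlays, Finset.card_filter]
  rw [h]
  refine Finset.measurable_sum _ fun t _ => Measurable.ite ?_ measurable_const measurable_const
  exact (measurable_fst.comp (measurable_pi_apply t)) (measurableSet_singleton k)

/-! ### Lower bounds on probabilities through the expected log-likelihood ratio -/

/-- If `Q` has density `exp (-L)` with respect to `P` on an event `E` and on its complement, then
`Q(E)` is at least `exp (-b)`, up to the factor on the left, whenever `b` exceeds the expected
log-likelihood ratio by enough. This is the data-processing inequality for the Kullback-Leibler
divergence in linearized form. -/
lemma exp_neg_mul_le_measureReal {Ω : Type*} [MeasurableSpace Ω] {P Q : Measure Ω}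
    [IsProbabilityMeasure P] [IsProbabilityMeasure Q] {L : Ω → ℝ} {E : Set Ω}
    (hE : MeasurableSet E) (hL : Integrable L P) (hexp : Integrable (fun ω => Real.exp (-L ω)) P)
    (hQE : Q.real E = ∫ ω in E, Real.exp (-L ω) ∂P)
    (hQEc : Q.real Eᶜ = ∫ ω in Eᶜ, Real.exp (-L ω) ∂P) (b : ℝ) :
    Real.exp (-b) * ((1 + b) * P.real E - ∫ ω, L ω ∂P - 1) ≤ Q.real E := by
  -- off `E`, the log-likelihood ratio contributes at least `-1`
  have hc : -∫ ω in Eᶜ, L ω ∂P ≤ 1 := by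
    rw [← integral_neg]
    refine le_trans ?_ (hQEc.symm.le.trans measureReal_le_one)
    exact integral_mono hL.integrableOn.neg hexp.integrableOn fun ω => by
      linarith [Real.add_one_le_exp (-L ω)]
  have hsplit := integral_add_compl hE hL
  have hE' : ∫ ω in E, Real.exp (-b) * (1 + b - L ω) ∂P ≤ ∫ ω in E, Real.exp (-L ω) ∂P := by
    refine integral_mono (((integrable_const _).sub hL.integrableOn).const_mul _)
      hexp.integrableOn fun ω => ?_
    -- the tangent of `exp` at `-b`
    have h := Real.add_one_le_exp (b - L ω)
    calc Real.exp (-b) * (1 + b - L ω) ≤ Real.exp (-b) * Real.exp (b - L ω) := by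
          gcongr; linarith
      _ = Real.exp (-L ω) := by rw [← Real.exp_add]; ring_nf
  rw [integral_const_mul, integral_sub (integrable_const _) hL.integrableOn] at hE'
  simp only [integral_const, measureReal_restrict_apply_univ, smul_eq_mul] at hE'
  rw [hQE]
  refine le_trans (mul_le_mul_of_nonneg_left ?_ (Real.exp_pos _).le) hE'
  linarith

namespace BanditAlgorithm

variable (π : BanditAlgorithm) (ν ν' : Fin 2 → Measure ℝ)
  [∀ k, IsProbabilityMeasure (ν k)] [∀ k, IsProbabilityMeasure (ν' k)]

lemma integrable_numPlays (k : Fin 2) (T : ℕ) :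
    Integrable (fun ω => (numPlays k T ω : ℝ)) (π.law ν) := by
  refine Integrable.of_bound (C := T) (by fun_prop) (ae_of_all _ fun ω => ?_)
  simpa using numPlays_le k T ω

lemma integral_numPlays (k : Fin 2) (T : ℕ) :
    ∫ ω, (numPlays k T ω : ℝ) ∂π.law ν =
      ∑ t ∈ Finset.range T, ((π.law ν).map fun ω => (ω t).1).real {k} := by
  simp_rw [numPlays_eq_sum]
  have hm (t : ℕ) : MeasurableSet {ω : ℕ → Fin 2 × ℝ | (ω t).1 = k} :=
    (measurable_fst.comp (measurable_pi_apply t)) (measurableSet_singleton k)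
  have hi (t : ℕ) (ω : ℕ → Fin 2 × ℝ) : (if (ω t).1 = k then (1 : ℝ) else 0) =
      {ω : ℕ → Fin 2 × ℝ | (ω t).1 = k}.indicator (fun _ => 1) ω := by
    simp [Set.indicator_apply]
  simp_rw [hi]
  rw [integral_finsetSum _ fun t _ => (integrable_const (1 : ℝ)).indicator (hm t)]
  refine Finset.sum_congr rfl fun t _ => ?_
  rw [integral_indicator_const _ (hm t), smul_eq_mul, mul_one, map_measureReal_apply (by fun_prop)
    (measurableSet_singleton k)]
  rfl

lemma integrable_map_eval {ψ : Fin 2 × ℝ → ℝ} (hψ : Measurable ψ)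
    (hint : ∀ a, Integrable (fun x => ψ (a, x)) (ν a)) (t : ℕ) :
    Integrable ψ ((π.law ν).map fun ω => ω t) := by
  have : IsProbabilityMeasure ((π.law ν).map fun ω => (ω t).1) :=
    Measure.isProbabilityMeasure_map (measurable_fst.comp (measurable_pi_apply t)).aemeasurable
  rw [map_eval_law, Measure.integrable_compProd_iff hψ.aestronglyMeasurable]
  exact ⟨ae_of_all _ hint, Integrable.of_finite⟩

lemma integral_eval {ψ : Fin 2 × ℝ → ℝ} (hψ : Measurable ψ)
    (hint : ∀ a, Integrable (fun x => ψ (a, x)) (ν a)) (t : ℕ) :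
    ∫ ω, ψ (ω t) ∂π.law ν =
      ∑ a, ((π.law ν).map fun ω => (ω t).1).real {a} * ∫ x, ψ (a, x) ∂ν a := by
  have : IsProbabilityMeasure ((π.law ν).map fun ω => (ω t).1) :=
    Measure.isProbabilityMeasure_map (measurable_fst.comp (measurable_pi_apply t)).aemeasurable
  have h := π.integrable_map_eval ν hψ hint t
  rw [← integral_map (φ := fun ω : ℕ → Fin 2 × ℝ => ω t) (f := ψ)
    (measurable_pi_apply t).aemeasurable hψ.aestronglyMeasurable]
  rw [map_eval_law] at h ⊢
  rw [Measure.integral_compProd h, integral_fintype Integrable.of_finite]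
  rfl

/-- If two environments differ only in the law of arm `0`, an event of the first `T` rounds that is
likely in one of them is not too unlikely in the other. The expected log-likelihood ratio of the
histories is the expected number of plays of arm `0` times that of a single reward. -/
lemma exp_neg_mul_le_law_real (h1 : ν' 1 = ν 1) {l : ℝ → ℝ} (hl : Measurable l)
    (hint : Integrable l (ν 0))
    (h0 : ν' 0 = (ν 0).withDensity fun x => ENNReal.ofReal (Real.exp (-l x)))
    (T : ℕ) {E : Set (ℕ → Fin 2 × ℝ)} (hE : MeasurableSet E)
    (hET : DependsOn (fun ω => ω ∈ E) (Set.Iio T)) (b : ℝ) :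
    Real.exp (-b) * ((1 + b) * (π.law ν).real E -
      (∫ ω, (numPlays 0 T ω : ℝ) ∂π.law ν) * ∫ x, l x ∂ν 0 - 1) ≤ (π.law ν').real E := by
  let ψ : Fin 2 × ℝ → ℝ := fun y => if y.1 = 0 then l y.2 else 0
  have hψ : Measurable ψ :=
    Measurable.ite (measurable_fst (measurableSet_singleton 0)) (by fun_prop) measurable_const
  have hψint (a : Fin 2) : Integrable (fun x => ψ (a, x)) (ν a) := by
    fin_cases a
    · simpa [ψ] using hint
    · simp [ψ]
  have hν (a : Fin 2) :
      ν' a = (ν a).withDensity fun x => ENNReal.ofReal (Real.exp (-ψ (a, x))) := by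
    fin_cases a
    · simpa [ψ] using h0
    · simpa [ψ] using h1
  let L : (ℕ → Fin 2 × ℝ) → ℝ := fun ω => ∑ t ∈ Finset.range T, ψ (ω t)
  have hLm : Measurable L := by fun_prop
  have hLt (t : ℕ) : Integrable (fun ω => ψ (ω t)) (π.law ν) :=
    (π.integrable_map_eval ν hψ hψint t).comp_measurable (measurable_pi_apply t)
  have hL : Integrable L (π.law ν) := integrable_finsetSum _ fun t _ => hLt t
  have hLint : ∫ ω, L ω ∂π.law ν =
      (∫ ω, (numPlays 0 T ω : ℝ) ∂π.law ν) * ∫ x, l x ∂ν 0 := by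
    rw [integral_finsetSum _ fun t _ => hLt t, integral_numPlays,
      Finset.sum_mul]
    refine Finset.sum_congr rfl fun t _ => ?_
    rw [π.integral_eval ν hψ hψint, Fin.sum_univ_two]
    simp [ψ]
  have hdens {F : Set (ℕ → Fin 2 × ℝ)} (hF : MeasurableSet F)
      (hFT : DependsOn (fun ω => ω ∈ F) (Set.Iio T)) :
      π.law ν' F = ∫⁻ ω in F, ENNReal.ofReal (Real.exp (-L ω)) ∂π.law ν := by
    have hdep : DependsOn (F.indicator (1 : (ℕ → Fin 2 × ℝ) → ENNReal)) (Set.Iio T) := by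
      intro ω ω' hω
      have hiff : (ω ∈ F) = (ω' ∈ F) := hFT hω
      by_cases hF' : ω' ∈ F <;> simp [hF', hiff]
    have h := π.lintegral_law_eq ν ν' (z := fun y => ENNReal.ofReal (Real.exp (-ψ y)))
      (by fun_prop) hν T (measurable_one.indicator hF) hdep
    rw [lintegral_indicator_one hF] at h
    rw [h, ← lintegral_indicator hF]
    refine lintegral_congr fun ω => ?_
    rw [← ENNReal.ofReal_prod_of_nonneg fun t _ => (Real.exp_pos _).le, ← Real.exp_sum,
      Finset.sum_neg_distrib]
    by_cases hω : ω ∈ F <;> simp [hω, L]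
  have hreal {F : Set (ℕ → Fin 2 × ℝ)} (hF : MeasurableSet F)
      (hFT : DependsOn (fun ω => ω ∈ F) (Set.Iio T)) :
      (π.law ν').real F = ∫ ω in F, Real.exp (-L ω) ∂π.law ν := by
    rw [measureReal_def, hdens hF hFT, integral_eq_lintegral_of_nonneg_ae
      (ae_of_all _ fun ω => (Real.exp_pos _).le) (by fun_prop)]
  have hexp : Integrable (fun ω => Real.exp (-L ω)) (π.law ν) := by
    refine ⟨by fun_prop, ?_⟩
    rw [hasFiniteIntegral_iff_ofReal (ae_of_all _ fun ω => (Real.exp_pos _).le),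
      ← setLIntegral_univ, ← hdens MeasurableSet.univ fun ω ω' _ => by simp]
    exact measure_lt_top _ _
  rw [← hLint]
  exact exp_neg_mul_le_measureReal hE hL hexp (hreal hE hET)
    (hreal hE.compl fun ω ω' hω => congrArg Not (hET hω)) b

end BanditAlgorithm

/-! ### Heavy tail of the number of plays of a sub-optimal arm -/

/-- Markov's inequality for the plays of arm `0`: if few of them are expected, then arm `1` most
likely receives at least half of the plays. -/
lemma BanditAlgorithm.one_sub_le_law_real_half (π : BanditAlgorithm) (ν : Fin 2 → Measure ℝ)
    [∀ k, IsProbabilityMeasure (ν k)] {T : ℕ} (hT : 0 < T) :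
    1 - 2 * (∫ ω, (numPlays 0 T ω : ℝ) ∂π.law ν) / T ≤
      (π.law ν).real {ω | T ≤ 2 * numPlays 1 T ω} := by
  have hT' : (0 : ℝ) < T := by exact_mod_cast hT
  have hm : MeasurableSet {ω : ℕ → Fin 2 × ℝ | T ≤ 2 * numPlays 1 T ω} :=
    measurableSet_le measurable_const (by fun_prop)
  have hsub : {ω : ℕ → Fin 2 × ℝ | T ≤ 2 * numPlays 1 T ω}ᶜ ⊆
      {ω | (T : ℝ) / 2 ≤ (numPlays 0 T ω : ℝ)} := by
    intro ω hω
    have h1 : ¬ T ≤ 2 * numPlays 1 T ω := hω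
    have h2 := numPlays_zero_add_one T ω
    have h3 : T ≤ 2 * numPlays 0 T ω := by omega
    have h4 : (T : ℝ) ≤ 2 * numPlays 0 T ω := by exact_mod_cast h3
    change (T : ℝ) / 2 ≤ numPlays 0 T ω
    linarith
  have hmarkov := mul_meas_ge_le_integral_of_nonneg
    (ae_of_all (π.law ν) fun ω => Nat.cast_nonneg (α := ℝ) (numPlays 0 T ω))
    (π.integrable_numPlays ν 0 T) ((T : ℝ) / 2)
  have hle := measureReal_mono (μ := π.law ν) hsub
  rw [probReal_compl_eq_one_sub hm] at hle
  have h5 : (T : ℝ) / 2 * (1 - (π.law ν).real {ω | T ≤ 2 * numPlays 1 T ω}) ≤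
      ∫ ω, (numPlays 0 T ω : ℝ) ∂π.law ν := le_trans (by gcongr) hmarkov
  rw [sub_le_comm, le_div_iff₀ hT']
  linarith

/-- In an environment where arm `1` is sub-optimal, an optimized algorithm nevertheless plays it at
least half of the time with a probability that decays hardly faster than `1 / T`. -/
lemma ExpFamily.eventually_rpow_neg_le_banditLaw_real (M : ExpFamily) (π : BanditAlgorithm)
    (hA1 : M.IsOptimized π) (hA2 : M.LeftTailCondition) (ν : Fin 2 → M.Θ) (hν : ν 1 < ν 0)
    {r : ℝ} (hr : 1 < r) :
    ∀ᶠ T : ℕ in atTop,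
      (T : ℝ) ^ (-r) ≤ (M.banditLaw π ν).real {ω | T ≤ 2 * numPlays 1 T ω} := by
  obtain ⟨θ, hθ, hθ1, hD, hDr⟩ := exists_D_lt_mul_D hA2 (ν 0).2 (ν 1).2 hν hr
  have hθm := interior_subset hθ
  -- the alternative environment, in which arm `0` is worse than arm `1`
  let ν' : Fin 2 → M.Θ := ![⟨θ, hθm⟩, ν 1]
  have hlim := hA1 ν' 1 0 hθ1
  let c : ℕ → ℝ := fun T => ∫ ω, (numPlays 0 T ω : ℝ) ∂(M.banditLaw π ν')
  change Tendsto (fun T : ℕ => c T / Real.log T) atTop (𝓝 (1 / M.D θ (ν 1))) at hlim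
  have hlog : Tendsto (fun T : ℕ => Real.log T) atTop atTop :=
    Real.tendsto_log_atTop.comp tendsto_natCast_atTop_atTop
  have hlogdiv : Tendsto (fun T : ℕ => Real.log T / T) atTop (𝓝 0) :=
    (Real.isLittleO_log_id_atTop.tendsto_div_nhds_zero).comp tendsto_natCast_atTop_atTop
  -- the exponent `r * log T` exceeds the expected log-likelihood ratio by an amount of order `log T`
  have hmain : Tendsto (fun T : ℕ => (1 + r * Real.log T) * (1 - 2 * c T / T) -
      c T * M.D θ (ν 0) - 1) atTop atTop := by
    have hinv : Tendsto (fun T : ℕ => ((T : ℝ))⁻¹) atTop (𝓝 0) := tendsto_inv_atTop_nhds_zero_nat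
    have hlim' : Tendsto (fun T : ℕ => r - 2 * (c T / Real.log T) * (T : ℝ)⁻¹ -
        2 * r * (c T / Real.log T) * (Real.log T / T) - c T / Real.log T * M.D θ (ν 0)) atTop
        (𝓝 (r - 2 * (1 / M.D θ (ν 1)) * 0 - 2 * r * (1 / M.D θ (ν 1)) * 0 -
          1 / M.D θ (ν 1) * M.D θ (ν 0))) :=
      ((tendsto_const_nhds.sub ((hlim.const_mul 2).mul hinv)).sub
        ((hlim.const_mul (2 * r)).mul hlogdiv)).sub (hlim.mul_const _)
    have hpos : 0 < r - 2 * (1 / M.D θ (ν 1)) * 0 - 2 * r * (1 / M.D θ (ν 1)) * 0 -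
        1 / M.D θ (ν 1) * M.D θ (ν 0) := by
      have := (div_lt_iff₀ hD).2 hDr
      rw [one_div_mul_eq_div]
      linarith
    refine (hlog.atTop_mul_pos hpos hlim').congr' ?_
    filter_upwards [eventually_gt_atTop 1] with T hT
    have h1 : Real.log T ≠ 0 := (Real.log_pos (by exact_mod_cast hT)).ne'
    have h2 : (T : ℝ) ≠ 0 := by positivity
    field_simp
    ring
  filter_upwards [hmain.eventually_ge_atTop 1, eventually_gt_atTop 1] with T hT hT1
  have hT0 : (0 : ℝ) < T := by positivity
  have hP0 : IsProbabilityMeasure (M.P θ) := M.isProbabilityMeasure_P ⟨θ, hθm⟩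
  have hbound := π.exp_neg_mul_le_law_real (fun k => M.P (ν' k)) (fun k => M.P (ν k)) rfl
    (l := fun x => M.A (ν 0) - M.A θ - (ν 0 - θ) * x) (by fun_prop)
    ((integrable_const _).sub ((integrable_id_P hθ).const_mul _))
    (P_eq_withDensity_P hθm (ν 0).2) T (E := {ω | T ≤ 2 * numPlays 1 T ω})
    (measurableSet_le measurable_const (by fun_prop))
    (fun ω ω' h => by
      change (T ≤ 2 * numPlays 1 T ω) = (T ≤ 2 * numPlays 1 T ω')
      rw [dependsOn_numPlays 1 T h])
    (r * Real.log T)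
  have hint : ∫ x, (M.A (ν 0) - M.A θ - (ν 0 - θ) * x) ∂M.P (ν' 0) = M.D θ (ν 0) :=
    (integral_logRatio_P hθ _).trans (D_eq hθ (ν 0).2).symm
  rw [hint] at hbound
  have hhalf := π.one_sub_le_law_real_half (fun k => M.P (ν' k)) (T := T) (by omega)
  have hlogT : 0 ≤ Real.log T := Real.log_nonneg (by exact_mod_cast hT1.le)
  refine le_trans ?_ hbound
  rw [Real.rpow_def_of_pos hT0, show Real.log T * -r = -(r * Real.log T) by ring]
  refine le_mul_of_one_le_right (Real.exp_pos _).le (hT.trans ?_)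
  have h1r : 0 ≤ 1 + r * Real.log T := by positivity
  have := mul_le_mul_of_nonneg_left hhalf h1r
  simp only [c, banditLaw] at *
  linarith

theorem corollary3 (M : ExpFamily) (π : BanditAlgorithm)
    (hA1 : M.IsOptimized π) (hA2 : M.LeftTailCondition)
    (ν : Fin 2 → M.Θ) (hν : ν 1 < ν 0)
    (δ δ' : ℝ) (hδ' : 0 < δ') (hδ : δ' < δ) :
    (1 : EReal) ≤ liminf (fun T : ℕ =>
      (((∫ ω, (numPlays 1 T ω : ℝ) ^ (1 + δ) ∂(M.banditLaw π ν)) / (T : ℝ) ^ δ' : ℝ) : EReal))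
      atTop := by
  -- any exponent strictly between `1` and `1 + δ - δ'` will do
  set r := 1 + (δ - δ') / 2 with hr
  have hgrow : Tendsto (fun T : ℕ => (T : ℝ) ^ ((δ - δ') / 2)) atTop atTop :=
    (tendsto_rpow_atTop (by linarith)).comp tendsto_natCast_atTop_atTop
  refine le_liminf_of_le (by isBoundedDefault) ?_
  filter_upwards [M.eventually_rpow_neg_le_banditLaw_real π hA1 hA2 ν hν (r := r) (by linarith),
    hgrow.eventually_ge_atTop (2 ^ (1 + δ)), eventually_gt_atTop 0] with T hq hT hT0
  have hT0' : (0 : ℝ) < T := by exact_mod_cast hT0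
  rw [← EReal.coe_one, EReal.coe_le_coe_iff, one_le_div (by positivity)]
  have : IsProbabilityMeasure (M.banditLaw π ν) := by
    unfold ExpFamily.banditLaw
    infer_instance
  have hmono : ((T : ℝ) / 2) ^ (1 + δ) * (M.banditLaw π ν).real {ω | T ≤ 2 * numPlays 1 T ω} ≤
      ∫ ω, (numPlays 1 T ω : ℝ) ^ (1 + δ) ∂(M.banditLaw π ν) := by
    have hint : Integrable (fun ω => (numPlays 1 T ω : ℝ) ^ (1 + δ)) (M.banditLaw π ν) := by
      refine Integrable.of_bound (C := (T : ℝ) ^ (1 + δ))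
        (Measurable.pow_const (by fun_prop) _).aestronglyMeasurable (ae_of_all _ fun ω => ?_)
      rw [Real.norm_of_nonneg (by positivity)]
      exact Real.rpow_le_rpow (by positivity) (by exact_mod_cast numPlays_le 1 T ω) (by linarith)
    refine le_trans ?_ (mul_meas_ge_le_integral_of_nonneg
      (ae_of_all _ fun ω => by positivity) hint (((T : ℝ) / 2) ^ (1 + δ)))
    refine mul_le_mul_of_nonneg_left (measureReal_mono fun ω hω => ?_) (by positivity)
    have h1 : T ≤ 2 * numPlays 1 T ω := hω
    have h2 : (T : ℝ) ≤ 2 * numPlays 1 T ω := by exact_mod_cast h1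
    exact Real.rpow_le_rpow (by positivity) (by linarith) (by linarith)
  refine le_trans ?_ hmono
  calc (T : ℝ) ^ δ' = (T : ℝ) ^ δ' * (2 ^ (1 + δ) / 2 ^ (1 + δ)) := by
        rw [div_self (by positivity), mul_one]
    _ ≤ (T : ℝ) ^ δ' * ((T : ℝ) ^ ((δ - δ') / 2) / 2 ^ (1 + δ)) := by gcongr
    _ = ((T : ℝ) / 2) ^ (1 + δ) * (T : ℝ) ^ (-r) := by
        rw [Real.div_rpow hT0'.le zero_le_two, mul_div_assoc', div_mul_eq_mul_div,
          ← Real.rpow_add hT0', ← Real.rpow_add hT0', hr]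
        ring_nf
    _ ≤ _ := by gcongr
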